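/- Let $B_q=\{0,1,\dots,q-1\}$. An $m\times n$ matrix $C$ over $B_q$ is called a $t$-covering array if for any $t$ distinct columns of $C$, each of the $q^t$ vectors of length $t$ over $B_q$ occurs at least once as a row of the $m\times t$ submatrix formed by these columns. Let $CAN(t,n,q)$ denote the least $m$ for which there exists an $m\times n$ $t$-covering array over $B_q$. Two $m\times n$ matrices over $B_q$ are called equivalent if one can be transformed into the other by a finite series of operations of the following types: (a) a permutation of the rows; (b) a permutation of the columns; (c) applying a permutation of $B_q$ to all the entries of one column. **Theorem.** $CAN(4,12,2)=24$, and there is a unique $24\times 12$ binary $4$-covering array up to equivalence; that is, a $24\times 12$ $4$-covering array over $B_2=\{0,1\}$ exists, and any two such arrays are equivalent. -/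

import Mathlib

namespace CovArr

/-- An `m × n` matrix `C` over `B_q = {0, …, q-1}` is a `t`-covering array if, for any `t`
(distinct) columns, every vector of length `t` over `B_q` occurs in some row. -/
def IsCoveringArray (t : ℕ) {m n q : ℕ} (C : Matrix (Fin m) (Fin n) (Fin q)) : Prop :=
  ∀ c : Fin t ↪ Fin n, ∀ v : Fin t → Fin q, ∃ i : Fin m, ∀ j : Fin t, C i (c j) = v j

/-- The covering array number: the least size `m` of a `t`-covering array of degree `n`
and order `q`. -/
noncomputable def CAN (t n q : ℕ) : ℕ :=
  sInf {m : ℕ | ∃ C : Matrix (Fin m) (Fin n) (Fin q), IsCoveringArray t C}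

/-- One elementary operation on an `m × n` matrix over `B_q`. -/
inductive Step {m n q : ℕ} :
    Matrix (Fin m) (Fin n) (Fin q) → Matrix (Fin m) (Fin n) (Fin q) → Prop
  | permRows (C : Matrix (Fin m) (Fin n) (Fin q)) (σ : Equiv.Perm (Fin m)) :
      Step C (C.submatrix σ id)
  | permCols (C : Matrix (Fin m) (Fin n) (Fin q)) (τ : Equiv.Perm (Fin n)) :
      Step C (C.submatrix id τ)
  | permValues (C : Matrix (Fin m) (Fin n) (Fin q)) (j : Fin n) (π : Equiv.Perm (Fin q)) :
      Step C (C.updateCol j (fun i => π (C i j)))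

/-- Two matrices are equivalent if one can be transformed into the other by a finite series
of elementary operations. (Each operation is reversible by one of the same type, so this
relation is symmetric.) -/
def Equivalent {m n q : ℕ} (C C' : Matrix (Fin m) (Fin n) (Fin q)) : Prop :=
  Relation.ReflTransGen Step C C'

end CovArr

/-! Fix two columns and split the rows into four blocks by their entries there. Within a block the
other ten columns are pairwise qualitatively independent, so their 20 fibres form an antichain.
Sperner gives at least six rows per block, hence `twentyfour_le`; the rows of a Hadamard matrix of
order 12 and their complements attain 24.

With 24 rows every block has exactly six, and equality in LYM makes the fibres all 20 triples of the
block. So any three columns are balanced, which fixes the first three moments of the inner products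
of a row with all rows. These force distinct rows to be orthogonal or complementary
(`rowInner_eq_zero_or`), and each row has its complement.

Since every triple occurs, the block `0, 0` can be relabelled to a standard form. Orthogonality to
it leaves two possibilities for the block `0, 1`, interchanged by swapping the two columns and
complementing; complements give the remaining rows. -/

namespace CovArr
open Finset

/-! ### The Hadamard array and its covering property -/

/-- Twelve rows of a normalised Hadamard matrix of order twelve, written over `{0, 1}`. -/
def halfArray : Fin 12 → Fin 12 → Fin 2 :=
  ![![0, 0, 0, 0, 0, 0, 0, 0, 0, 0, 0, 0],
    ![0, 0, 0, 0, 0, 0, 1, 1, 1, 1, 1, 1],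
    ![0, 0, 0, 1, 1, 1, 0, 0, 0, 1, 1, 1],
    ![0, 0, 1, 0, 1, 1, 0, 1, 1, 0, 0, 1],
    ![0, 0, 1, 1, 0, 1, 1, 0, 1, 0, 1, 0],
    ![0, 0, 1, 1, 1, 0, 1, 1, 0, 1, 0, 0],
    ![0, 1, 0, 0, 1, 1, 1, 0, 1, 1, 0, 0],
    ![0, 1, 0, 1, 0, 1, 1, 1, 0, 0, 0, 1],
    ![0, 1, 0, 1, 1, 0, 0, 1, 1, 0, 1, 0],
    ![0, 1, 1, 0, 0, 1, 0, 1, 0, 1, 1, 0],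
    ![0, 1, 1, 0, 1, 0, 1, 0, 0, 0, 1, 1],
    ![0, 1, 1, 1, 0, 0, 0, 0, 1, 1, 0, 1]]

/-- The rows of `halfArray` followed by their complements. -/
def hadamardRow (i : Fin 24) (j : Fin 12) : Fin 2 :=
  if h : i.1 < 12 then halfArray ⟨i, h⟩ j else 1 - halfArray ⟨i - 12, by omega⟩ j

/-- The array with rows `hadamardRow`. -/
def hadamardArray : Matrix (Fin 24) (Fin 12) (Fin 2) := Matrix.of hadamardRow

/-- The set of rows with entry `v` in column `c`, encoded as the binary digits of a number. -/
def rowMask (c : Fin 12) (v : Fin 2) : ℕ :=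
  if v = 0 then 16777215 - columnCode c else columnCode c
where
  /-- The set of rows with entry `1` in column `c`. -/
  columnCode : Fin 12 → ℕ := ![16773120, 262080, 1867320, 6601140, 11089260, 13775580, 11588850, 12932010, 6969690, 5872230, 9344790, 3611790]

lemma testBit_rowMask : ∀ (c : Fin 12) (v : Fin 2) (i : Fin 24), (rowMask c v).testBit i = true →
    hadamardArray i c = v := by
  decide +kernel

lemma rowMask_lt : ∀ (c : Fin 12) (v : Fin 2), rowMask c v < 2 ^ 24 := by
  decide +kernel

/-- With rows as bits, each coverage check is a bitwise AND; ordering the columns avoids repeating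
it for their permutations. -/
lemma rowMask_land_ne_zero : ∀ a b, a < b → ∀ c, b < c → ∀ d, c < d → ∀ v w x y : Fin 2,
    rowMask a v &&& rowMask b w &&& rowMask c x &&& rowMask d y ≠ 0 := by
  decide +kernel

lemma hadamardArray_cover_sorted {a b c d : Fin 12} (hab : a < b) (hbc : b < c) (hcd : c < d)
    (v w x y : Fin 2) : ∃ i : Fin 24, hadamardArray i a = v ∧ hadamardArray i b = w ∧
      hadamardArray i c = x ∧ hadamardArray i d = y := by
  obtain ⟨i, hi⟩ := Nat.exists_testBit_of_ne_zero (rowMask_land_ne_zero a b hab c hbc d hcd v w x y)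
  simp only [Nat.testBit_land, Bool.and_eq_true] at hi
  obtain ⟨⟨⟨h1, h2⟩, h3⟩, h4⟩ := hi
  have hi : i < 24 := by
    by_contra! h
    rw [Nat.testBit_lt_two_pow ((rowMask_lt a v).trans_le (Nat.pow_le_pow_right two_pos h))] at h1
    exact absurd h1 (by decide)
  exact ⟨⟨i, hi⟩, testBit_rowMask a v ⟨i, hi⟩ h1, testBit_rowMask b w ⟨i, hi⟩ h2,
    testBit_rowMask c x ⟨i, hi⟩ h3, testBit_rowMask d y ⟨i, hi⟩ h4⟩

lemma hadamardArray_injective : Function.Injective hadamardArray := by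
  have h : ∀ i k : Fin 24, i ≠ k → ∃ j, hadamardRow i j ≠ hadamardRow k j := by
    decide +kernel
  intro i k hik
  by_contra hne
  obtain ⟨j, hj⟩ := h i k hne
  exact hj (congrFun hik j)

lemma isCoveringArray_hadamardArray : IsCoveringArray 4 hadamardArray := by
  intro c v
  have hT : (univ.map c).card = 4 := by simp
  let e := (univ.map c).orderEmbOfFin hT
  -- Transporting `v` to the columns themselves allows them to be sorted.
  let u : Fin 12 → Fin 2 := fun x => v (Function.invFun c x)
  obtain ⟨i, h0, h1, h2, h3⟩ := hadamardArray_cover_sorted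
    (e.strictMono (show (0 : Fin 4) < 1 by decide)) (e.strictMono (show (1 : Fin 4) < 2 by decide))
    (e.strictMono (show (2 : Fin 4) < 3 by decide))
    (u (e 0)) (u (e 1)) (u (e 2)) (u (e 3))
  refine ⟨i, fun j => ?_⟩
  have hj : c j ∈ Set.range e := by
    rw [Finset.range_orderEmbOfFin]; simp
  obtain ⟨k, hk⟩ := hj
  have hu : u (c j) = v j := by simp [u, Function.leftInverse_invFun c.injective j]
  rw [← hu, ← hk]
  fin_cases k <;> assumption

/-- The sign attached to a binary symbol. -/
def sgn (b : Fin 2) : ℤ := if b = 0 then 1 else -1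

set_option maxRecDepth 100000 in
/-- A sign vector starting with `0, 1` that is orthogonal to the first six rows of `halfArray` is,
up to complementing its last ten entries, one of the last six rows. -/
lemma eq_halfArray_of_orthogonal : ∀ x : Fin 10 → Fin 2,
    (∀ a : Fin 6, ∑ k, sgn (x k) * sgn (halfArray (Fin.castAdd 6 a) (Fin.natAdd 2 k)) = 0) →
    (∃ b : Fin 6, ∀ k, x k = halfArray (Fin.natAdd 6 b) (Fin.natAdd 2 k)) ∨
    (∃ b : Fin 6, ∀ k, x k = 1 - halfArray (Fin.natAdd 6 b) (Fin.natAdd 2 k)) := by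
  decide +kernel

/-! ### Qualitatively independent bipartitions and antichains -/

section TwoCovering
variable {α κ : Type*} [Fintype α] [Fintype κ]

/-- The points at which the column `p.1` has the entry `p.2`. -/
def fiberSet (f : κ → α → Fin 2) (p : κ × Fin 2) : Finset α := {a | f p.1 a = p.2}

/-- Fibres of one column are disjoint and nonempty; for two columns, independence gives a point in
the first fibre outside the second. -/
lemma fiberSet_not_subset {f : κ → α → Fin 2} (hκ : 2 ≤ Fintype.card κ)
    (hf : ∀ i j, i ≠ j → ∀ u v, ∃ a, f i a = u ∧ f j a = v)
    {p q : κ × Fin 2} (hpq : p ≠ q) : ¬ fiberSet f p ⊆ fiberSet f q := by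
  intro h
  by_cases hi : p.1 = q.1
  · have hb : p.2 ≠ q.2 := fun hb => hpq (Prod.ext hi hb)
    have : Nontrivial κ := Fintype.one_lt_card_iff_nontrivial.1 hκ
    obtain ⟨j, hj⟩ := exists_ne p.1
    obtain ⟨a, ha, -⟩ := hf p.1 j hj.symm p.2 0
    have := @h a (by simp [fiberSet, ha])
    simp only [fiberSet, mem_filter, mem_univ, true_and, ← hi, ha] at this
    exact hb this
  · obtain ⟨a, ha, hb⟩ := hf p.1 q.1 hi p.2 (1 - q.2)
    have := @h a (by simp [fiberSet, ha])
    simp only [fiberSet, mem_filter, mem_univ, true_and, hb] at this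
    revert this
    generalize q.2 = v
    revert v
    decide

lemma fiberSet_injective {f : κ → α → Fin 2} (hκ : 2 ≤ Fintype.card κ)
    (hf : ∀ i j, i ≠ j → ∀ u v, ∃ a, f i a = u ∧ f j a = v) :
    Function.Injective (fiberSet f) := fun p q h => by
  by_contra hpq
  exact fiberSet_not_subset hκ hf hpq h.subset

variable [DecidableEq α]

lemma isAntichain_image_fiberSet {f : κ → α → Fin 2} (hκ : 2 ≤ Fintype.card κ)
    (hf : ∀ i j, i ≠ j → ∀ u v, ∃ a, f i a = u ∧ f j a = v) :
    IsAntichain (· ⊆ ·) ((univ.image (fiberSet f) : Finset (Finset α)) : Set (Finset α)) := by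
  intro s hs t ht hst
  simp only [coe_image, coe_univ, Set.image_univ, Set.mem_range] at hs ht
  obtain ⟨p, rfl⟩ := hs
  obtain ⟨q, rfl⟩ := ht
  exact fiberSet_not_subset hκ hf fun h => hst (by rw [h])

/-- Ten pairwise qualitatively independent bipartitions need at least six points. -/
lemma six_le_card_of_two_covering {f : κ → α → Fin 2} (hκ : Fintype.card κ = 10)
    (hf : ∀ i j, i ≠ j → ∀ u v, ∃ a, f i a = u ∧ f j a = v) : 6 ≤ Fintype.card α := by
  have h := (isAntichain_image_fiberSet (by omega) hf).sperner
  rw [card_image_of_injective _ (fiberSet_injective (by omega) hf), card_univ, Fintype.card_prod,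
    hκ, Fintype.card_fin] at h
  by_contra! hlt
  generalize Fintype.card α = n at h hlt
  -- At most five points carry an antichain of size at most 10, less than 20.
  interval_cases n <;> simp [Nat.choose] at h

/-- Each of the 20 LYM terms is at least `1/20`, strictly unless the fibre has size 3, while their
sum is at most 1. -/
lemma card_fiberSet_eq_three {f : κ → α → Fin 2} (hκ : Fintype.card κ = 10)
    (hα : Fintype.card α = 6)
    (hf : ∀ i j, i ≠ j → ∀ u v, ∃ a, f i a = u ∧ f j a = v) (p : κ × Fin 2) :
    #(fiberSet f p) = 3 := by
  have h := lubell_yamamoto_meshalkin_inequality_sum_inv_choose (𝕜 := ℚ)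
    (isAntichain_image_fiberSet (by omega) hf)
  rw [sum_image fun _ _ _ _ h => fiberSet_injective (by omega) hf h, hα] at h
  have key : ∀ n ≤ 6, (1 / 20 : ℚ) ≤ ((Nat.choose 6 n : ℕ) : ℚ)⁻¹ ∧
      (n ≠ 3 → (1 / 20 : ℚ) < ((Nat.choose 6 n : ℕ) : ℚ)⁻¹) := by
    intro n hn
    interval_cases n <;> norm_num [Nat.choose]
  have hle (q : κ × Fin 2) : #(fiberSet f q) ≤ 6 := hα ▸ card_le_univ _
  by_contra hp
  have hlt : ∑ _q : κ × Fin 2, (1 / 20 : ℚ) <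
      ∑ q, ((Nat.choose 6 #(fiberSet f q) : ℕ) : ℚ)⁻¹ :=
    sum_lt_sum (fun q _ => (key _ (hle q)).1) ⟨p, mem_univ _, (key _ (hle p)).2 hp⟩
  have h20 : ∑ _q : κ × Fin 2, (1 / 20 : ℚ) = 1 := by
    simp [hκ]
  linarith

/-- On six points, ten pairwise qualitatively independent bipartitions realise every bipartition
into two triples. -/
lemma exists_fiberSet_eq {f : κ → α → Fin 2} (hκ : Fintype.card κ = 10)
    (hα : Fintype.card α = 6)
    (hf : ∀ i j, i ≠ j → ∀ u v, ∃ a, f i a = u ∧ f j a = v) {s : Finset α} (hs : #s = 3) :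
    ∃ p, fiberSet f p = s := by
  have h : univ.image (fiberSet f) = powersetCard 3 univ := by
    refine eq_of_subset_of_card_le ?_ ?_
    · intro t ht
      obtain ⟨p, -, rfl⟩ := mem_image.1 ht
      exact mem_powersetCard.2 ⟨subset_univ _, card_fiberSet_eq_three hκ hα hf p⟩
    · rw [card_image_of_injective _ (fiberSet_injective (by omega) hf), card_powersetCard,
        card_univ, card_univ, Fintype.card_prod, hκ, hα, Fintype.card_fin]
      decide
  have : s ∈ univ.image (fiberSet f) := h ▸ mem_powersetCard.2 ⟨subset_univ _, hs⟩
  simpa using this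

end TwoCovering

/-! ### Equivalence of matrices -/

section Equivalence
variable {m n q : ℕ}

lemma Equivalent.trans {A B C : Matrix (Fin m) (Fin n) (Fin q)} (h : Equivalent A B)
    (h' : Equivalent B C) : Equivalent A C := Relation.ReflTransGen.trans h h'

lemma Step.symm {A B : Matrix (Fin m) (Fin n) (Fin q)} (h : Step A B) : Step B A := by
  cases h with
  | permRows σ =>
    have := Step.permRows (A.submatrix σ id) σ⁻¹
    rwa [show (A.submatrix σ id).submatrix (σ⁻¹ : Equiv.Perm _) id = A by ext; simp] at this
  | permCols τ =>
    have := Step.permCols (A.submatrix id τ) τ⁻¹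
    rwa [show (A.submatrix id τ).submatrix id (τ⁻¹ : Equiv.Perm _) = A by ext; simp] at this
  | permValues j π =>
    have := Step.permValues (A.updateCol j (fun i => π (A i j))) j π⁻¹
    rwa [show (A.updateCol j (fun i => π (A i j))).updateCol j
      (fun i => (π⁻¹ : Equiv.Perm _) ((A.updateCol j (fun i => π (A i j))) i j)) = A by
        ext i k; by_cases hk : k = j <;> simp [hk]] at this

lemma Equivalent.symm {A B : Matrix (Fin m) (Fin n) (Fin q)} (h : Equivalent A B) :
    Equivalent B A := by
  induction h with
  | refl => exact .refl
  | tail _ hs ih => exact .head hs.symm ih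

lemma equivalent_permValues (A : Matrix (Fin m) (Fin n) (Fin q))
    (π : Fin n → Equiv.Perm (Fin q)) : Equivalent A (Matrix.of fun i j => π j (A i j)) := by
  suffices H : ∀ s : Finset (Fin n),
      Equivalent A (Matrix.of fun i j => if j ∈ s then π j (A i j) else A i j) by
    simpa using H univ
  intro s
  induction s using Finset.induction_on with
  | empty =>
    have heq : (Matrix.of fun i j => if j ∈ (∅ : Finset (Fin n)) then π j (A i j) else A i j) =
        A := by
      ext; simp
    rw [heq]
    exact Relation.ReflTransGen.refl
  | insert k s hk ih =>
    refine ih.tail ?_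
    have heq : (Matrix.of fun i j => if j ∈ insert k s then π j (A i j) else A i j) =
        (Matrix.of fun i j => if j ∈ s then π j (A i j) else A i j).updateCol k
          (fun i => π k ((Matrix.of fun i j => if j ∈ s then π j (A i j) else A i j) i k)) := by
      ext i j
      by_cases hj : j = k
      · subst hj; simp [hk]
      · simp [hj]
    rw [heq]
    exact Step.permValues _ k (π k)

/-- If every row of `B`, whose rows are distinct, is a row of `A` after permuting columns and
relabelling symbols columnwise, then `A` and `B` are equivalent. -/
lemma equivalent_of_rows {A B : Matrix (Fin m) (Fin n) (Fin q)} (hB : Function.Injective B)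
    (τ : Equiv.Perm (Fin n)) (π : Fin n → Equiv.Perm (Fin q))
    (h : ∀ i, ∃ i', ∀ j, B i j = π j (A i' (τ j))) : Equivalent A B := by
  choose σ hσ using h
  have hinj : Function.Injective σ := fun i k hik => hB (by ext j; rw [hσ, hσ, hik])
  let σ' : Equiv.Perm (Fin m) := Equiv.ofBijective σ (Finite.injective_iff_bijective.1 hinj)
  have h1 : Equivalent A ((A.submatrix σ' id).submatrix id τ) :=
    (Relation.ReflTransGen.single (Step.permRows A σ')).tail (Step.permCols _ τ)
  have heq : B = Matrix.of fun i j => π j (((A.submatrix σ' id).submatrix id τ) i j) := by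
    ext i j : 2
    rw [hσ]
    rfl
  rw [heq]
  exact h1.trans (equivalent_permValues _ π)

end Equivalence

/-! ### Blocks of rows and the lower bound -/

section Blocks
variable {m : ℕ} {C : Matrix (Fin m) (Fin 12) (Fin 2)}

lemma exists_row_of_pairwise_ne (hC : IsCoveringArray 4 C) {a b c d : Fin 12} (hab : a ≠ b)
    (hac : a ≠ c) (had : a ≠ d) (hbc : b ≠ c) (hbd : b ≠ d) (hcd : c ≠ d) (u v x y : Fin 2) :
    ∃ i, C i a = u ∧ C i b = v ∧ C i c = x ∧ C i d = y := by
  have hinj : Function.Injective ![a, b, c, d] := by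
    intro i j
    fin_cases i <;> fin_cases j <;>
      simp [hab, hac, had, hbc, hbd, hcd, hab.symm, hac.symm, had.symm, hbc.symm, hbd.symm,
        hcd.symm]
  obtain ⟨i, hi⟩ := hC ⟨_, hinj⟩ ![u, v, x, y]
  exact ⟨i, hi 0, hi 1, hi 2, hi 3⟩

/-- The rows of `C` with entries `u`, `v` in the columns `c`, `d`. -/
abbrev Block (C : Matrix (Fin m) (Fin 12) (Fin 2)) (c d : Fin 12) (u v : Fin 2) : Type :=
  {i : Fin m // C i c = u ∧ C i d = v}

/-- The columns other than `c` and `d`. -/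
abbrev OtherCols (c d : Fin 12) : Type := {j : Fin 12 // j ≠ c ∧ j ≠ d}

lemma card_otherCols : ∀ c d : Fin 12, c ≠ d → Fintype.card (OtherCols c d) = 10 := by
  decide +kernel

lemma block_two_covering (hC : IsCoveringArray 4 C) {c d : Fin 12} (hcd : c ≠ d) (u v : Fin 2)
    (i j : OtherCols c d) (hij : i ≠ j) (x y : Fin 2) :
    ∃ a : Block C c d u v, C a i = x ∧ C a j = y := by
  obtain ⟨r, h1, h2, h3, h4⟩ := exists_row_of_pairwise_ne hC hcd i.2.1.symm j.2.1.symm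
    i.2.2.symm j.2.2.symm (fun h => hij (Subtype.ext h)) u v x y
  exact ⟨⟨r, h1, h2⟩, h3, h4⟩

lemma six_le_card_block (hC : IsCoveringArray 4 C) {c d : Fin 12} (hcd : c ≠ d) (u v : Fin 2) :
    6 ≤ Fintype.card (Block C c d u v) :=
  six_le_card_of_two_covering (f := fun (j : OtherCols c d) (a : Block C c d u v) => C a j)
    (card_otherCols c d hcd) (block_two_covering hC hcd u v)

lemma sum_blocks {M : Type*} [AddCommMonoid M] (C : Matrix (Fin m) (Fin 12) (Fin 2))
    (c d : Fin 12) (g : Fin m → M) :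
    ∑ i, g i = ∑ p : Fin 2 × Fin 2, ∑ a : Block C c d p.1 p.2, g a := by
  rw [← sum_fiberwise univ (fun i => (C i c, C i d)) g]
  refine sum_congr rfl fun p _ => ?_
  rw [← sum_subtype_eq_sum_filter]
  rw [sum_subtype_eq_sum_filter, ← sum_subtype (p := fun i => C i c = p.1 ∧ C i d = p.2)]
  intro i
  simp [Prod.ext_iff]

lemma sum_card_block (C : Matrix (Fin m) (Fin 12) (Fin 2)) (c d : Fin 12) :
    ∑ p : Fin 2 × Fin 2, Fintype.card (Block C c d p.1 p.2) = m := by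
  have := sum_blocks C c d (fun _ => 1)
  simpa [Fintype.card_subtype] using this.symm

lemma twentyfour_le (hC : IsCoveringArray 4 C) : 24 ≤ m := by
  rw [← sum_card_block C 0 1]
  calc 24 = ∑ _p : Fin 2 × Fin 2, 6 := by simp
    _ ≤ _ := sum_le_sum fun p _ => six_le_card_block hC (by decide) _ _

end Blocks

/-! ### Moments of row inner products -/

section Moments
variable {C : Matrix (Fin 24) (Fin 12) (Fin 2)}

lemma card_block (hC : IsCoveringArray 4 C) {c d : Fin 12} (hcd : c ≠ d) (u v : Fin 2) :
    Fintype.card (Block C c d u v) = 6 := by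
  by_contra h
  have hlt : ∑ _p : Fin 2 × Fin 2, 6 < ∑ p : Fin 2 × Fin 2, Fintype.card (Block C c d p.1 p.2) :=
    sum_lt_sum (fun p _ => six_le_card_block hC hcd _ _)
      ⟨(u, v), mem_univ _, lt_of_le_of_ne (six_le_card_block hC hcd u v) (Ne.symm h)⟩
  rw [sum_card_block] at hlt
  simp at hlt

lemma sum_block_sgn (hC : IsCoveringArray 4 C) {c d e : Fin 12} (hcd : c ≠ d) (hec : e ≠ c)
    (hed : e ≠ d) (u v : Fin 2) : ∑ a : Block C c d u v, sgn (C a e) = 0 := by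
  have h (b : Fin 2) := card_fiberSet_eq_three
    (f := fun (j : OtherCols c d) (a : Block C c d u v) => C a j)
    (card_otherCols c d hcd) (card_block hC hcd u v) (block_two_covering hC hcd u v)
    (⟨e, hec, hed⟩, b)
  have key : ∀ b : Fin 2, sgn b = (if b = 0 then 1 else 0) - (if b = 1 then 1 else 0) := by
    decide
  have h0 := h 0
  have h1 := h 1
  simp only [fiberSet] at h0 h1
  simp only [key, sum_sub_distrib, sum_boole, h0, h1, sub_self]

lemma sum_mul_sgn (hC : IsCoveringArray 4 C) {c d e : Fin 12} (hcd : c ≠ d) (hec : e ≠ c)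
    (hed : e ≠ d) (g : Fin 2 → Fin 2 → ℤ) : ∑ i, g (C i c) (C i d) * sgn (C i e) = 0 := by
  rw [sum_blocks C c d]
  refine sum_eq_zero fun p _ => ?_
  rw [sum_congr rfl (g := fun a : Block C c d p.1 p.2 => g p.1 p.2 * sgn (C a e))
    (fun a _ => by rw [a.2.1, a.2.2]), ← mul_sum, sum_block_sgn hC hcd hec hed, mul_zero]

lemma sgn_mul_self : ∀ b, sgn b * sgn b = 1 := by decide

lemma exists_ne_ne : ∀ c d : Fin 12, ∃ e, e ≠ c ∧ e ≠ d := by decide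

lemma sum_sgn (hC : IsCoveringArray 4 C) (c : Fin 12) : ∑ i, sgn (C i c) = 0 := by
  obtain ⟨d, hd, -⟩ := exists_ne_ne c c
  obtain ⟨e, he, he'⟩ := exists_ne_ne c d
  simpa using sum_mul_sgn hC he'.symm hd.symm he.symm (fun _ _ => 1)

lemma sum_sgn_mul_sgn (hC : IsCoveringArray 4 C) (c d : Fin 12) :
    ∑ i, sgn (C i c) * sgn (C i d) = if c = d then 24 else 0 := by
  split_ifs with h
  · subst h; simp [sgn_mul_self]
  · obtain ⟨e, he, he'⟩ := exists_ne_ne c d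
    exact sum_mul_sgn hC he.symm (Ne.symm h) he'.symm (fun x _ => sgn x)

lemma sum_sgn_mul_sgn_mul_sgn (hC : IsCoveringArray 4 C) (c d e : Fin 12) :
    ∑ i, sgn (C i c) * sgn (C i d) * sgn (C i e) = 0 := by
  by_cases hcd : c = d
  · subst hcd; simpa [sgn_mul_self] using sum_sgn hC e
  by_cases hec : e = c
  · subst hec
    simpa [mul_right_comm _ _ (sgn (C _ e)), sgn_mul_self] using sum_sgn hC d
  by_cases hed : e = d
  · subst hed; simpa [mul_assoc, sgn_mul_self] using sum_sgn hC c
  exact sum_mul_sgn hC hcd hec hed (fun x y => sgn x * sgn y)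

/-- The inner product of two rows, read as sign vectors. -/
def rowInner (x y : Fin 12 → Fin 2) : ℤ := ∑ c, sgn (x c) * sgn (y c)

lemma rowInner_self (x : Fin 12 → Fin 2) : rowInner x x = 12 := by
  simp [rowInner, sgn_mul_self]

lemma neg_one_le_sgn_mul_sgn : ∀ a b, -1 ≤ sgn a * sgn b := by decide

lemma neg_twelve_le_rowInner (x y : Fin 12 → Fin 2) : -12 ≤ rowInner x y := by
  calc (-12 : ℤ) = ∑ _c : Fin 12, -1 := by simp
    _ ≤ _ := sum_le_sum fun c _ => neg_one_le_sgn_mul_sgn _ _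

lemma eq_compl_of_rowInner {x y : Fin 12 → Fin 2} (h : rowInner x y = -12) (c : Fin 12) :
    y c = 1 - x c := by
  have h1 : ∑ _c : Fin 12, (-1 : ℤ) = ∑ c, sgn (x c) * sgn (y c) := by
    rw [← rowInner, h]; simp
  have h2 := (sum_eq_sum_iff_of_le fun c _ => neg_one_le_sgn_mul_sgn (x c) (y c)).1 h1 c
    (mem_univ c)
  revert h2
  generalize x c = a
  generalize y c = b
  revert a b
  decide

lemma sum_rowInner (hC : IsCoveringArray 4 C) (x : Fin 12 → Fin 2) :
    ∑ i, rowInner x (C i) = 0 := by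
  simp only [rowInner]
  rw [sum_comm]
  simp [← mul_sum, sum_sgn hC]

lemma sum_rowInner_sq (hC : IsCoveringArray 4 C) (x : Fin 12 → Fin 2) :
    ∑ i, rowInner x (C i) ^ 2 = 288 := by
  have h (i : Fin 24) : rowInner x (C i) ^ 2 =
      ∑ c, ∑ d, sgn (x c) * sgn (x d) * (sgn (C i c) * sgn (C i d)) := by
    rw [sq, rowInner, sum_mul_sum]
    exact sum_congr rfl fun c _ => sum_congr rfl fun d _ => by ring
  simp only [h]
  rw [sum_comm]
  have h' (c : Fin 12) : ∑ i, ∑ d, sgn (x c) * sgn (x d) * (sgn (C i c) * sgn (C i d)) = 24 := by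
    rw [sum_comm]
    simp [← mul_sum, sum_sgn_mul_sgn hC, sgn_mul_self]
  simp [h']

lemma sum_rowInner_cube (hC : IsCoveringArray 4 C) (x : Fin 12 → Fin 2) :
    ∑ i, rowInner x (C i) ^ 3 = 0 := by
  have h (i : Fin 24) : rowInner x (C i) ^ 3 = ∑ c, ∑ d, ∑ e,
      sgn (x c) * sgn (x d) * sgn (x e) * (sgn (C i c) * sgn (C i d) * sgn (C i e)) := by
    rw [pow_succ, sq, rowInner, sum_mul_sum, sum_mul]
    refine sum_congr rfl fun c _ => ?_
    rw [sum_mul]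
    refine sum_congr rfl fun d _ => ?_
    rw [mul_sum]
    exact sum_congr rfl fun e _ => by ring
  simp only [h]
  rw [sum_comm]
  refine sum_eq_zero fun c _ => ?_
  rw [sum_comm]
  refine sum_eq_zero fun d _ => ?_
  rw [sum_comm]
  refine sum_eq_zero fun e _ => ?_
  rw [← mul_sum, sum_sgn_mul_sgn_mul_sgn hC, mul_zero]

/-- Distinct rows are orthogonal or complementary. -/
lemma rowInner_eq_zero_or (hC : IsCoveringArray 4 C) {r i : Fin 24} (hir : i ≠ r) :
    rowInner (C r) (C i) = 0 ∨ rowInner (C r) (C i) = -12 := by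
  set f : Fin 24 → ℤ := fun i => rowInner (C r) (C i) with hf
  -- The moments give `0 + 12 * 288`, which equals `12 ^ 2 * 24`, the term of `r` alone. The others
  -- are nonnegative as `f i ≥ -12`, so they vanish.
  have hsum : ∑ i, f i ^ 2 * (f i + 12) = 3456 := by
    have : ∀ i, f i ^ 2 * (f i + 12) = f i ^ 3 + 12 * f i ^ 2 := fun i => by ring
    simp only [this, sum_add_distrib, ← mul_sum]
    simp only [hf, sum_rowInner_sq hC, sum_rowInner_cube hC]
    norm_num
  have hr : f r = 12 := rowInner_self _
  rw [← add_sum_erase _ _ (mem_univ r), hr] at hsum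
  have h0 : ∑ i ∈ univ.erase r, f i ^ 2 * (f i + 12) = 0 := by linarith
  have hi := (sum_eq_zero_iff_of_nonneg fun i _ =>
    mul_nonneg (sq_nonneg (f i)) (by linarith [neg_twelve_le_rowInner (C r) (C i)])).1 h0 i
    (mem_erase.2 ⟨hir, mem_univ i⟩)
  rcases mul_eq_zero.1 hi with h | h
  · exact .inl (pow_eq_zero_iff two_ne_zero |>.1 h)
  · exact .inr (by linarith)

/-- Otherwise `r` is orthogonal to all other rows and its inner products sum to 12, not 0. -/
lemma exists_compl_row (hC : IsCoveringArray 4 C) (r : Fin 24) :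
    ∃ i, ∀ c, C i c = 1 - C r c := by
  by_contra! hcon
  have h0 : ∀ i, i ≠ r → rowInner (C r) (C i) = 0 := fun i hi =>
    (rowInner_eq_zero_or hC hi).resolve_right fun h => by
      obtain ⟨c, hc⟩ := hcon i
      exact hc (eq_compl_of_rowInner h c)
  have h := sum_rowInner hC (C r)
  rw [sum_eq_single r (fun i _ hi => h0 i hi) (by simp), rowInner_self] at h
  norm_num at h

lemma rowInner_eq_zero (hC : IsCoveringArray 4 C) {r i : Fin 24} (hir : i ≠ r) {c : Fin 12}
    (hc : C i c = C r c) : rowInner (C r) (C i) = 0 := by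
  refine (rowInner_eq_zero_or hC hir).resolve_right fun h => ?_
  have := eq_compl_of_rowInner h c
  rw [hc] at this
  revert this
  generalize C r c = a
  revert a
  decide

end Moments

/-! ### Normalising the block `0, 0` -/

section Normalisation
variable {C : Matrix (Fin 24) (Fin 12) (Fin 2)}

/-- The entries of the first six rows of `halfArray` outside the first two columns. -/
abbrev tripleEntry (a : Fin 6) (k : Fin 10) : Fin 2 :=
  halfArray (Fin.castAdd 6 a) (Fin.natAdd 2 k)

/-- The entries of the last six rows of `halfArray` outside the first two columns. -/
abbrev dualEntry (b : Fin 6) (k : Fin 10) : Fin 2 :=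
  halfArray (Fin.natAdd 6 b) (Fin.natAdd 2 k)

/-- With the next two lemmas: the ten columns are the ten triples avoiding point 0, one from each
bipartition into triples. -/
lemma card_tripleEntry : ∀ k, #{a | tripleEntry a k = 1} = 3 := by decide +kernel

lemma tripleEntry_zero : ∀ k, tripleEntry 0 k = 0 := by decide +kernel

lemma tripleEntry_separates : ∀ k l, k ≠ l → ∃ a, tripleEntry a k ≠ tripleEntry a l := by
  decide +kernel

lemma halfArray_castAdd_castAdd :
    ∀ (a : Fin 6) (j : Fin 2), halfArray (Fin.castAdd 6 a) (Fin.castAdd 10 j) = 0 := by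
  decide +kernel

lemma swap_one_eq : ∀ x y z : Fin 2, (x = y ↔ z = 1) → Equiv.swap y 1 x = z := by decide

lemma exists_column_eq_tripleEntry (hC : IsCoveringArray 4 C) (e : Fin 6 ≃ Block C 0 1 0 0)
    (k : Fin 10) : ∃ p : OtherCols 0 1 × Fin 2,
      ∀ a, C (e a) p.1 = p.2 ↔ tripleEntry a k = 1 := by
  obtain ⟨p, hp⟩ := exists_fiberSet_eq
    (f := fun (j : OtherCols 0 1) (a : Block C 0 1 0 0) => C a j)
    (card_otherCols 0 1 (by decide)) (card_block hC (by decide) 0 0)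
    (block_two_covering hC (by decide) 0 0)
    (s := ({a | tripleEntry a k = 1} : Finset (Fin 6)).map e.toEmbedding)
    (by rw [card_map, card_tripleEntry])
  refine ⟨p, fun a => ?_⟩
  have := congrArg (e a ∈ ·) hp
  simpa [fiberSet] using this

/-- A covering array can be relabelled so that its rows starting with `0, 0` are the first six
rows of `halfArray`. -/
lemma exists_normalisation (hC : IsCoveringArray 4 C) :
    ∃ (τ : Equiv.Perm (Fin 12)) (π : Fin 12 → Equiv.Perm (Fin 2)),
      ∀ a : Fin 6, ∃ i, ∀ j, π j (C i (τ j)) = halfArray (Fin.castAdd 6 a) j := by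
  have hcard : Fintype.card (Block C 0 1 0 0) = 6 := card_block hC (by decide) 0 0
  let e : Fin 6 ≃ Block C 0 1 0 0 := (Fintype.equivFinOfCardEq hcard).symm
  choose p hp using exists_column_eq_tripleEntry hC e
  have hpinj : Function.Injective fun k => (p k).1 := by
    intro k l (hkl : (p k).1 = (p l).1)
    by_contra hne
    -- Equal values would give equal triples; opposite values give complementary ones, but point 0
    -- lies in neither.
    by_cases hv : (p k).2 = (p l).2
    · obtain ⟨a, ha⟩ := tripleEntry_separates k l hne
      have h1 := hp k a
      rw [hkl, hv, hp l a] at h1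
      have : ∀ x y : Fin 2, (y = 1 ↔ x = 1) → x = y := by decide
      exact ha (this _ _ h1)
    · have h1 := hp k 0
      have h2 := hp l 0
      rw [tripleEntry_zero] at h1 h2
      rw [hkl] at h1
      have : ∀ x y z : Fin 2, y ≠ z → (x = y ↔ (0 : Fin 2) = 1) → ¬ (x = z ↔ (0 : Fin 2) = 1) := by
        decide
      exact this _ _ _ hv h1 h2
  let t : Fin (2 + 10) → Fin 12 :=
    Fin.addCases (fun i : Fin 2 => Fin.castAdd 10 i) (fun k => (p k).1)
  have hl : ∀ i : Fin 2, t (Fin.castAdd 10 i) = Fin.castAdd 10 i := fun i => Fin.addCases_left i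
  have hr : ∀ k : Fin 10, t (Fin.natAdd 2 k) = (p k).1 := fun k => Fin.addCases_right k
  have hne : ∀ (i : Fin 2) (k : Fin 10), (Fin.castAdd 10 i : Fin 12) ≠ (p k).1 := by
    intro i k h
    have h0 := (p k).1.2
    rw [← h] at h0
    fin_cases i
    · exact h0.1 rfl
    · exact h0.2 rfl
  have ht : Function.Injective t := by
    intro x y
    refine Fin.addCases (fun i => ?_) (fun k => ?_) x <;>
      refine Fin.addCases (fun j => ?_) (fun l => ?_) y
    · rw [hl, hl]; exact id
    · rw [hl, hr]; exact fun h => absurd h (hne i l)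
    · rw [hr, hl]; exact fun h => absurd h.symm (hne j k)
    · rw [hr, hr]; exact fun h => by rw [hpinj (Subtype.ext h)]
  let π : Fin (2 + 10) → Equiv.Perm (Fin 2) :=
    Fin.addCases (fun _ => Equiv.refl _) (fun k => Equiv.swap (p k).2 1)
  have πl : ∀ i : Fin 2, π (Fin.castAdd 10 i) = Equiv.refl _ := fun i => Fin.addCases_left i
  have πr : ∀ k : Fin 10, π (Fin.natAdd 2 k) = Equiv.swap (p k).2 1 :=
    fun k => Fin.addCases_right k
  refine ⟨Equiv.ofBijective t (Finite.injective_iff_bijective.1 ht), π, fun a => ⟨e a, fun j => ?_⟩⟩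
  rw [Equiv.ofBijective_apply]
  refine Fin.addCases (m := 2) (n := 10) (fun i => ?_) (fun k => ?_) j
  · rw [πl, hl, halfArray_castAdd_castAdd]
    fin_cases i
    · exact (e a).2.1
    · exact (e a).2.2
  · rw [πr, hr]
    exact swap_one_eq _ _ _ (hp k a)

lemma isCoveringArray_relabel {t m n q : ℕ} {C : Matrix (Fin m) (Fin n) (Fin q)}
    (hC : IsCoveringArray t C) (τ : Equiv.Perm (Fin n)) (π : Fin n → Equiv.Perm (Fin q)) :
    IsCoveringArray t (Matrix.of fun i j => π j (C i (τ j))) := by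
  intro c v
  obtain ⟨i, hi⟩ := hC (c.trans τ.toEmbedding) (fun j => (π (c j)).symm (v j))
  refine ⟨i, fun j => ?_⟩
  have := hi j
  simp only [Function.Embedding.trans_apply, Equiv.coe_toEmbedding] at this
  simp [this]

end Normalisation

/-! ### Determining the remaining rows -/

section Uniqueness
variable {D : Matrix (Fin 24) (Fin 12) (Fin 2)}

lemma rowInner_eq (x y : Fin 12 → Fin 2) : rowInner x y = sgn (x 0) * sgn (y 0) +
    sgn (x 1) * sgn (y 1) + ∑ k : Fin 10, sgn (x (Fin.natAdd 2 k)) * sgn (y (Fin.natAdd 2 k)) := by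
  have h := Fin.sum_univ_add (a := 2) (b := 10) fun c => sgn (x c) * sgn (y c)
  rw [Fin.sum_univ_two] at h
  exact h

lemma block_entries (hD : IsCoveringArray 4 D)
    (hY : ∀ a : Fin 6, ∃ i, ∀ j, D i j = halfArray (Fin.castAdd 6 a) j) (r : Block D 0 1 0 1) :
    (∃ b, ∀ k, D r (Fin.natAdd 2 k) = dualEntry b k) ∨
      (∃ b, ∀ k, D r (Fin.natAdd 2 k) = 1 - dualEntry b k) := by
  refine eq_halfArray_of_orthogonal (fun k => D r (Fin.natAdd 2 k)) fun a => ?_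
  obtain ⟨i, hi⟩ := hY a
  have hi0 : D i 0 = 0 := (hi 0).trans (halfArray_castAdd_castAdd a 0)
  have hi1 : D i 1 = 0 := (hi 1).trans (halfArray_castAdd_castAdd a 1)
  have hne : i ≠ r := by
    rintro rfl
    have := r.2.2
    rw [hi1] at this
    exact absurd this (by decide)
  have h := rowInner_eq_zero hD hne (hi0.trans r.2.1.symm)
  rw [rowInner_eq, hi0, hi1, r.2.1, r.2.2] at h
  simpa [sgn, hi] using h

/-- Two rows with the same label would have inner product 12 instead of 0, so the six rows use all
six labels. -/
lemma exists_block_row (hD : IsCoveringArray 4 D) (g : Fin 6 → Fin 10 → Fin 2)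
    (h : ∀ r : Block D 0 1 0 1, ∃ b, ∀ k, D r (Fin.natAdd 2 k) = g b k) (b : Fin 6) :
    ∃ r : Block D 0 1 0 1, ∀ k, D r (Fin.natAdd 2 k) = g b k := by
  choose β hβ using h
  have hinj : Function.Injective β := by
    intro r s hrs
    by_contra hne
    have h0 := rowInner_eq_zero hD (r := r) (i := s) (c := 0)
      (fun h => hne (Subtype.ext h.symm)) (s.2.1.trans r.2.1.symm)
    rw [rowInner_eq, r.2.1, r.2.2, s.2.1, s.2.2] at h0
    simp [hβ, hrs, sgn_mul_self] at h0
  have hbij : Function.Bijective β := (Fintype.bijective_iff_injective_and_card β).2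
    ⟨hinj, by rw [card_block hD (by decide), Fintype.card_fin]⟩
  obtain ⟨r, rfl⟩ := hbij.2 b
  exact ⟨r, hβ r⟩

lemma dualEntry_ne_compl : ∀ b c, ∃ k, dualEntry b k ≠ 1 - dualEntry c k := by decide +kernel

lemma dualEntry_not_orthogonal_compl :
    ∀ b c, 2 + ∑ k, sgn (dualEntry b k) * sgn (1 - dualEntry c k) ≠ 0 := by
  decide +kernel

/-- Rows of the block agree in column 0, so distinct ones are orthogonal, which a dual row and a
complemented one never are. -/
lemma block_dichotomy (hD : IsCoveringArray 4 D)
    (hY : ∀ a : Fin 6, ∃ i, ∀ j, D i j = halfArray (Fin.castAdd 6 a) j) :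
    (∀ r : Block D 0 1 0 1, ∃ b, ∀ k, D r (Fin.natAdd 2 k) = dualEntry b k) ∨
      (∀ r : Block D 0 1 0 1, ∃ b, ∀ k, D r (Fin.natAdd 2 k) = 1 - dualEntry b k) := by
  by_contra! hcon
  obtain ⟨⟨r, hr⟩, ⟨s, hs⟩⟩ := hcon
  obtain ⟨b, hb⟩ := (block_entries hD hY s).resolve_right fun ⟨b, hb⟩ => by
    obtain ⟨k, hk⟩ := hs b
    exact hk (hb k)
  obtain ⟨c, hc⟩ := (block_entries hD hY r).resolve_left fun ⟨b, hb⟩ => by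
    obtain ⟨k, hk⟩ := hr b
    exact hk (hb k)
  by_cases hrs : r = s
  · obtain ⟨k, hk⟩ := dualEntry_ne_compl b c
    exact hk (by rw [← hb, ← hc, hrs])
  · have h := rowInner_eq_zero hD (r := s) (i := r) (c := 0) (fun h => hrs (Subtype.ext h))
      (r.2.1.trans s.2.1.symm)
    rw [rowInner_eq, r.2.1, r.2.2, s.2.1, s.2.2] at h
    simp only [hb, hc] at h
    exact dualEntry_not_orthogonal_compl b c h

lemma halfArray_natAdd_zero : ∀ b : Fin 6, halfArray (Fin.natAdd 6 b) 0 = 0 := by decide +kernel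

lemma halfArray_natAdd_one : ∀ b : Fin 6, halfArray (Fin.natAdd 6 b) 1 = 1 := by decide +kernel

lemma forall_fin_twelve {P : Fin 12 → Prop} (h0 : P 0) (h1 : P 1)
    (h : ∀ k : Fin 10, P (Fin.natAdd 2 k)) (j : Fin 12) : P j := by
  refine Fin.addCases (m := 2) (n := 10) (fun i => ?_) h j
  fin_cases i
  · exact h0
  · exact h1

lemma one_sub_one_sub : ∀ x : Fin 2, 1 - (1 - x) = x := by decide

lemma exists_perm_halfArray (hD : IsCoveringArray 4 D)
    (hY : ∀ a : Fin 6, ∃ i, ∀ j, D i j = halfArray (Fin.castAdd 6 a) j) :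
    ∃ τ : Equiv.Perm (Fin 12), ∀ i, ∃ i', ∀ j, halfArray i j = D i' (τ j) := by
  rcases block_dichotomy hD hY with h | h
  · refine ⟨1, fun i => ?_⟩
    refine Fin.addCases (m := 6) (n := 6) (fun a => ?_) (fun b => ?_) i
    · obtain ⟨i', hi'⟩ := hY a
      exact ⟨i', fun j => (hi' j).symm⟩
    · obtain ⟨r, hr⟩ := exists_block_row hD _ h b
      refine ⟨r, forall_fin_twelve ?_ ?_ fun k => (hr k).symm⟩
      · exact (halfArray_natAdd_zero b).trans r.2.1.symm
      · exact (halfArray_natAdd_one b).trans r.2.2.symm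
  · have hτ (k : Fin 10) : Equiv.swap (0 : Fin 12) 1 (Fin.natAdd 2 k) = Fin.natAdd 2 k := by
      revert k; decide
    -- Complementing a row `0, 1, 1 - d` gives `1, 0, d`, and the swap restores `0, 1, d`; rows
    -- starting `0, 0` are unaffected.
    refine ⟨Equiv.swap 0 1, fun i => ?_⟩
    refine Fin.addCases (m := 6) (n := 6) (fun a => ?_) (fun b => ?_) i
    · obtain ⟨i', hi'⟩ := hY a
      refine ⟨i', forall_fin_twelve ?_ ?_ fun k => ?_⟩
      · rw [Equiv.swap_apply_left, hi']
        exact (halfArray_castAdd_castAdd a 0).trans (halfArray_castAdd_castAdd a 1).symm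
      · rw [Equiv.swap_apply_right, hi']
        exact (halfArray_castAdd_castAdd a 1).trans (halfArray_castAdd_castAdd a 0).symm
      · rw [hτ, hi']
    · obtain ⟨r, hr⟩ := exists_block_row hD _ h b
      obtain ⟨s, hs⟩ := exists_compl_row hD r
      refine ⟨s, forall_fin_twelve ?_ ?_ fun k => ?_⟩
      · rw [Equiv.swap_apply_left, hs, r.2.2, halfArray_natAdd_zero, sub_self]
      · rw [Equiv.swap_apply_right, hs, r.2.1, halfArray_natAdd_one, sub_zero]
      · rw [hτ, hs, hr, one_sub_one_sub]

lemma exists_perm_hadamardRow (hD : IsCoveringArray 4 D)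
    (hY : ∀ a : Fin 6, ∃ i, ∀ j, D i j = halfArray (Fin.castAdd 6 a) j) :
    ∃ τ : Equiv.Perm (Fin 12), ∀ i, ∃ i', ∀ j, hadamardRow i j = D i' (τ j) := by
  obtain ⟨τ, hτ⟩ := exists_perm_halfArray hD hY
  refine ⟨τ, fun i => ?_⟩
  unfold hadamardRow
  split_ifs with h
  · exact hτ _
  · obtain ⟨r, hr⟩ := hτ ⟨i - 12, by omega⟩
    obtain ⟨s, hs⟩ := exists_compl_row hD r
    exact ⟨s, fun j => by rw [hr, hs]⟩

/-- Every `24 × 12` binary covering array of strength four is equivalent to `hadamardArray`. -/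
lemma equivalent_hadamardArray {C : Matrix (Fin 24) (Fin 12) (Fin 2)}
    (hC : IsCoveringArray 4 C) : Equivalent C hadamardArray := by
  obtain ⟨τ, π, h⟩ := exists_normalisation hC
  obtain ⟨τ', h'⟩ := exists_perm_hadamardRow (isCoveringArray_relabel hC τ π) h
  exact equivalent_of_rows hadamardArray_injective (τ'.trans τ) (fun j => π (τ' j)) h'

end Uniqueness

lemma can_four_twelve_two : CAN 4 12 2 = 24 :=
  le_antisymm (Nat.sInf_le ⟨hadamardArray, isCoveringArray_hadamardArray⟩)
    (le_csInf ⟨24, hadamardArray, isCoveringArray_hadamardArray⟩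
      fun _ ⟨_, hC⟩ => twentyfour_le hC)

end CovArr

theorem theorem5p7 :
    CovArr.CAN 4 12 2 = 24 ∧
    ∃ C : Matrix (Fin 24) (Fin 12) (Fin 2), CovArr.IsCoveringArray 4 C ∧
      ∀ C' : Matrix (Fin 24) (Fin 12) (Fin 2),
        CovArr.IsCoveringArray 4 C' → CovArr.Equivalent C C' :=
  ⟨CovArr.can_four_twelve_two, CovArr.hadamardArray, CovArr.isCoveringArray_hadamardArray,
    fun _ hC => (CovArr.equivalent_hadamardArray hC).symm⟩
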